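/- Let $G$ be a finite group and let $\chi$ be an irreducible complex character of $G$ afforded by a representation $\mathcal{X}\colon G\to \mathrm{GL}_d(\mathbb{C})$. Write $(\alpha,\beta)=\frac{1}{|G|}\sum_{g\in G}\alpha(g)\overline{\beta(g)}$ for the Schur inner product, $o(\cdot)$ for the multiplicative order, and let $c(\chi)$ be the conductor of $\chi$, i.e. the smallest positive integer $n$ such that $\mathbb{Q}(\chi)$ is contained in the $n$-th cyclotomic field $\mathbb{Q}_n$. Let $\mathcal{M}(G)$ be the set of pairs $(H,\varphi)$ with $H\le G$ and $\varphi\colon H\to\mathbb{C}^\times$ a linear character, partially ordered by $(K,\psi)\le(H,\varphi)$ iff $K\le H$ and $\psi=\varphi|_K$; $G$ acts on it by conjugation, and $[H,\varphi]_G$ denotes the orbit of $(H,\varphi)$. Let $\alpha_{[H,\varphi]_G}(\chi)$ be the coefficients of the canonical Brauer induction formula $$a_G(\chi)=\sum_{[H,\varphi]_G}\alpha_{[H,\varphi]_G}(\chi)\,[H,\varphi]_G=\frac{1}{|G|}\sum_{(H_0,\varphi_0)<\cdots<(H_m,\varphi_m)}(-1)^m\,|H_0|\,(\chi_{H_m},\varphi_m)\,[H_0,\varphi_0]_G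 ,$$ where the sum on the right runs over all chains in $\mathcal{M}(G)$. For a positive integer $n$ put $$S(G,\chi,n)=\sum_{[H,\varphi]_G,\ n\mid o(\varphi)}\alpha_{[H,\varphi]_G}(\chi),\qquad F(G,\chi)=S(G,\chi,c(\chi)).$$ Let $\pi(n)$ be the set of prime divisors of $n$. For $\rho\subseteq\pi(n)$ put $n(\rho)=\exp(G)_{\rho'}\cdot\bigl(n/\prod_{p\in\pi(n)}p\bigr)_\rho$, where $m_\rho$ and $m_{\rho'}$ denote the $\rho$-part and the $\rho'$-part of a positive integer $m$, and let $\Psi^k(\chi)(g)=\chi(g^k)$ be the $k$-th Adams operation. Then, with $n=c(\chi)$, $$F(G,\chi)=\Bigl(\sum_{\rho\subseteq\pi(n)}(-1)^{|\rho|}\,\Psi^{n(\rho)}(\chi),\ 1_G\Bigr),$$ and the following are equivalent: (i) Conjecture A holds for $(G,\chi)$, i.e. there are a subgroup $H\le G$ and a linear constituent $\varphi$ of the restriction $\chi_H$ with $o(\varphi)=c(\chi)$; (ii) $F(G,\chi)>0$; (ii') the multiplicity of the trivial character $1_G$ in the virtual character $\sum_{\rho\subseteq\pi(n)}(-1)^{|\rho|}\,\Psi^{n(\rho)}(\chi)$,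 with $n=c(\chi)$, is positive; (iii) there are an element $x\in G$ and an eigenvalue $\zeta$ of $\mathcal{X}(x)$ with $o(\zeta)=c(\chi)$. -/

import Mathlib

open scoped ComplexOrder

/-- The Schur inner product `(α, β) = |G|⁻¹ ∑ α(g) conj(β(g))` of class functions of a finite
group. -/
noncomputable def schurInner {G : Type*} [Group G] (α β : G → ℂ) : ℂ :=
  (Nat.card G : ℂ)⁻¹ * ∑ᶠ g : G, α g * (starRingEnd ℂ) (β g)

/-- The field `ℚ(χ)` generated by the values of `χ`, as a subfield of `ℂ`. -/
noncomputable def valueField {G : Type*} (χ : G → ℂ) : IntermediateField ℚ ℂ :=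
  IntermediateField.adjoin ℚ (Set.range χ)

/-- The `n`-th cyclotomic field `ℚ_n`, as a subfield of `ℂ`. -/
noncomputable def cyclotomicSubfield (n : ℕ) : IntermediateField ℚ ℂ :=
  IntermediateField.adjoin ℚ {z : ℂ | z ^ n = 1}

/-- The conductor `c(χ)`: the smallest positive `n` with `ℚ(χ) ⊆ ℚ_n`. -/
noncomputable def charConductor {G : Type*} (χ : G → ℂ) : ℕ :=
  sInf {n : ℕ | 0 < n ∧ valueField χ ≤ cyclotomicSubfield n}

/-- The poset `ℳ(G)` of pairs `(H, φ)` with `H` a subgroup of `G` and `φ` a linear character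
of `H`. -/
@[ext]
structure LinPair (G : Type*) [Group G] where
  grp : Subgroup G
  lin : grp →* ℂˣ

namespace LinPair

variable {G : Type*} [Group G]

/-- The multiplicity `(χ_H, φ)` of the linear character `φ` in the restriction `χ_H`. -/
noncomputable def mult (χ : G → ℂ) (P : LinPair G) : ℂ :=
  schurInner (fun h : P.grp => χ h) (fun h : P.grp => (P.lin h : ℂ))

/-- `(K, ψ) ≤ (H, φ)` if and only if `K ≤ H` and `ψ = φ_K`. -/
instance : PartialOrder (LinPair G) where
  le P Q := ∃ h : P.grp ≤ Q.grp, P.lin = Q.lin.comp (Subgroup.inclusion h)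
  le_refl P := ⟨le_refl _, rfl⟩
  le_trans := by
    rintro P Q R ⟨h, e⟩ ⟨k, f⟩
    exact ⟨le_trans h k, by rw [e, f]; rfl⟩
  le_antisymm := by
    rintro ⟨A, a⟩ ⟨B, b⟩ ⟨h, e⟩ ⟨k, f⟩
    dsimp only at h k e f
    obtain rfl := le_antisymm h k
    have : a = b := e
    rw [this]

/-- `Q = ᵍP` for some `g : G`, where `ᵍ(H, φ) = (gHg⁻¹, ᵍφ)` and `(ᵍφ)(ghg⁻¹) = φ(h)`. -/
def Conj (P Q : LinPair G) : Prop :=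
  ∃ g : G, ∃ hg : ∀ h : G, h ∈ P.grp ↔ g * h * g⁻¹ ∈ Q.grp,
    ∀ (h : G) (hh : h ∈ P.grp), Q.lin ⟨g * h * g⁻¹, (hg h).1 hh⟩ = P.lin ⟨h, hh⟩

/-- The equivalence relation on `ℳ(G)` whose classes are the `G`-orbits. -/
def conjSetoid (G : Type*) [Group G] : Setoid (LinPair G) where
  r := Conj
  iseqv := by
    refine ⟨fun P => ⟨1, by simp, by simp⟩, ?_, ?_⟩
    · rintro P Q ⟨g, hg, h⟩
      have key : ∀ x, x ∈ Q.grp ↔ g⁻¹ * x * g⁻¹⁻¹ ∈ P.grp := fun x => by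
        rw [hg]; simp [mul_assoc]
      refine ⟨g⁻¹, key, fun x hx => ?_⟩
      rw [← h _ ((key x).1 hx)]
      congr 2
      group
    · rintro P Q R ⟨g, hg, h⟩ ⟨k, hk, h'⟩
      refine ⟨k * g, fun x => ?_, fun x hx => ?_⟩
      · rw [hg, hk]; simp [mul_assoc]
      · rw [← h x hx, ← h' _ ((hg x).1 hx)]
        congr 2
        group

/-- The set of `G`-orbits `[H, φ]_G` on `ℳ(G)`. -/
def Orbit (G : Type*) [Group G] : Type _ := Quotient (conjSetoid G)

/-- The orbit `[H, φ]_G` of a pair `(H, φ)`. -/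
def orbit (P : LinPair G) : Orbit G := Quotient.mk (conjSetoid G) P

theorem Conj.orderOf_eq {P Q : LinPair G} (hPQ : Conj P Q) : orderOf P.lin = orderOf Q.lin := by
  obtain ⟨g, hg, h⟩ := hPQ
  have surj : ∀ y : Q.grp, ∃ x, ∃ hx : x ∈ P.grp, y = ⟨g * x * g⁻¹, (hg x).1 hx⟩ := by
    rintro ⟨y, hy⟩
    have e : g * (g⁻¹ * y * g) * g⁻¹ = y := by group
    refine ⟨g⁻¹ * y * g, (hg _).2 (by rwa [e]), Subtype.ext e.symm⟩
  refine orderOf_eq_orderOf_iff.2 fun n => ⟨fun hn => ?_, fun hn => ?_⟩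
  · ext y
    obtain ⟨x, hx, rfl⟩ := surj y
    have := DFunLike.congr_fun hn ⟨x, hx⟩
    rw [MonoidHom.pow_apply] at this ⊢
    rw [h x hx, this]; rfl
  · ext ⟨x, hx⟩
    have := DFunLike.congr_fun hn ⟨g * x * g⁻¹, (hg x).1 hx⟩
    rw [MonoidHom.pow_apply] at this ⊢
    rw [← h, this]; rfl

/-- The order `o(φ)`, a function of the orbit `[H, φ]_G`. -/
noncomputable def Orbit.order (q : Orbit G) : ℕ :=
  Quotient.lift (s := conjSetoid G) (fun P : LinPair G => orderOf P.lin)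
    (fun _ _ h => Conj.orderOf_eq h) q

instance [Finite G] : Finite (LinPair G) := by
  have fin : ∀ H : Subgroup G, Finite (H →* ℂˣ) := fun H => by
    have : Finite (rootsOfUnity (Nat.card H) ℂ) := inferInstance
    refine Finite.of_injective
      (fun (f : H →* ℂˣ) (h : H) => (⟨f h, by
        rw [mem_rootsOfUnity, ← map_pow, pow_card_eq_one', map_one]⟩ :
          rootsOfUnity (Nat.card H) ℂ)) ?_
    intro f g e
    ext h
    have := congrFun e h
    simp only [Subtype.mk.injEq] at this
    rw [this]
  exact Finite.of_injective (fun P : LinPair G => (⟨P.grp, P.lin⟩ : Σ H : Subgroup G, H →* ℂˣ))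
    (by rintro ⟨A, a⟩ ⟨B, b⟩ h; cases h; rfl)

instance [Finite G] : Finite (Orbit G) := by
  unfold Orbit; infer_instance

/-- There are only finitely many chains `(H₀, φ₀) < ⋯ < (Hₙ, φₙ)` in `ℳ(G)`. -/
instance [Finite G] : Finite (LTSeries (LinPair G)) := by
  classical
  have := Fintype.ofFinite (LinPair G)
  infer_instance

end LinPair

/-- The coefficient `α_{[H, φ]_G}(χ)` of `[H, φ]_G` in the canonical Brauer induction formula
`a_G(χ) = |G|⁻¹ ∑ (-1)ⁿ |H₀| (χ_{Hₙ}, φₙ) [H₀, φ₀]_G`, where the sum runs over all chains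
`(H₀, φ₀) < ⋯ < (Hₙ, φₙ)`, `n ≥ 0`, in the poset `ℳ(G)`. -/
noncomputable def brauerCoeff {G : Type*} [Group G] (χ : G → ℂ) (q : LinPair.Orbit G) : ℂ :=
  (Nat.card G : ℂ)⁻¹ * ∑ᶠ (c : LTSeries (LinPair G)) (_ : c.head.orbit = q),
    (-1) ^ c.length * (Nat.card c.head.grp : ℂ) * c.last.mult χ

/-- `S(G, χ, n)`: the sum of the coefficients `α_{[H, φ]_G}(χ)` over all orbits `[H, φ]_G` with
`n ∣ o(φ)`. -/
noncomputable def brauerSum {G : Type*} [Group G] (χ : G → ℂ) (n : ℕ) : ℂ :=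
  ∑ᶠ (q : LinPair.Orbit G) (_ : n ∣ q.order), brauerCoeff χ q

/-- `F(G, χ) = S(G, χ, c(χ))`. -/
noncomputable def feitIndicator {G : Type*} [Group G] (χ : G → ℂ) : ℂ :=
  brauerSum χ (charConductor χ)

/-- The `k`-th Adams operation `Ψᵏ(χ)(g) = χ(gᵏ)`. -/
def adamsOp {G : Type*} [Group G] (k : ℕ) (χ : G → ℂ) : G → ℂ := fun g => χ (g ^ k)

/-- The part `n_ρ` of a positive integer `n` for a finite set `ρ` of primes. -/
def primePart (ρ : Finset ℕ) (n : ℕ) : ℕ := ∏ p ∈ n.primeFactors ∩ ρ, p ^ n.factorization p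

/-- The part `n_{ρ'}` of a positive integer `n`, where `ρ'` is the set of primes not in `ρ`. -/
def primeCoPart (ρ : Finset ℕ) (n : ℕ) : ℕ := ∏ p ∈ n.primeFactors \ ρ, p ^ n.factorization p

/-- `n(ρ) = exp(G)_{ρ'} · (n / ∏_{p ∣ n} p)_ρ`. -/
noncomputable def adamsExponent (G : Type*) [Group G] (n : ℕ) (ρ : Finset ℕ) : ℕ :=
  primeCoPart ρ (Monoid.exponent G) * primePart ρ (n / ∏ p ∈ n.primeFactors, p)

/-- The virtual character `∑_{ρ ⊆ π(n)} (-1)^{|ρ|} Ψ^{n(ρ)}(χ)`. -/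
noncomputable def alternatingAdams {G : Type*} [Group G] (χ : G → ℂ) (n : ℕ) : G → ℂ := fun g =>
  ∑ ρ ∈ n.primeFactors.powerset, (-1) ^ ρ.card * adamsOp (adamsExponent G n ρ) χ g

/-- Conjecture A for `(G, χ)`: for some subgroup `H` of `G`, the restriction `χ_H` has a linear
constituent `φ` whose order is the conductor of `χ`. -/
def ConjectureA {G : Type*} [Group G] (χ : G → ℂ) : Prop :=
  ∃ P : LinPair G, 0 < P.mult χ ∧ orderOf P.lin = charConductor χ

/-! Fourier inversion on the cyclic groups ⟨x⟩ expresses χ(xᵏ) through the multiplicities (χ_⟨x⟩,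
ψ), and Möbius cancellation turns each of these into a sum over chains of ℳ(G). Averaging over x,
the multiplicity of 1_G in Ψᵏ(χ) is the chain sum of the Brauer formula restricted to heads with
o(φ₀) ∣ k (`schurInner_adamsOp_one`). For d ∣ exp(G) and ρ ⊆ π(n), d ∣ n(ρ) means v_p(d) < v_p(n)
for all p ∈ ρ, so inclusion-exclusion over ρ detects n ∣ d and yields the formula for F.

For positivity, note that this multiplicity depends only on which divisors of exp(G) divide k. Hence
n(ρ) may be replaced by ∑_{p ∈ ρ} ±m_p with m_p = exp(G)_{p'} p^(v_p(n)-1) and arbitrary signs. The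
alternating sum then factors, at each eigenvalue z of x, as ∏ (1 - z^(±m_p)); averaging over the
signs replaces each factor by |1 - z^(m_p)|² / 2 (`two_pow_mul_schurInner_alternatingAdams`). All
terms are now nonnegative, and one is nonzero exactly when n ∣ o(z) for some eigenvalue z; a power
of x then has an eigenvalue of order n. Eigenvalues and linear constituents correspond through
cyclic subgroups. -/

/-! ### Chains in a finite poset -/

/-- Möbius cancellation over the chains lying above a fixed element of a finite poset. -/
theorem LTSeries.sum_neg_one_pow_length_of_le_head {α R : Type*} [PartialOrder α]
    [Fintype (LTSeries α)] [DecidableLE α] [CommRing R] (a : α) (f : α → R) :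
    ∑ c : LTSeries α with a ≤ c.head, (-1) ^ c.length * f c.last = f a := by
  classical
  -- Prepending `a` matches the chains starting strictly above `a` with the longer chains starting
  -- at `a`. It flips the sign and keeps the last element, so only the one-element chain `a`
  -- survives.
  have hsplit : (Finset.univ.filter fun c : LTSeries α => a ≤ c.head) =
      insert (RelSeries.singleton _ a) ((Finset.univ.filter fun c : LTSeries α => a < c.head) ∪
        Finset.univ.filter fun c : LTSeries α => c.head = a ∧ c.length ≠ 0) := by
    ext c
    simp only [Finset.mem_filter, Finset.mem_univ, true_and, Finset.mem_insert, Finset.mem_union]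
    constructor
    · intro h
      rcases h.lt_or_eq with h | h
      · exact Or.inr (Or.inl h)
      · by_cases hl : c.length = 0
        · left
          refine RelSeries.ext (by simpa using hl) ?_
          funext i
          have hi : i = 0 := by ext; have := i.2; simp; omega
          subst hi
          exact h.symm
        · exact Or.inr (Or.inr ⟨h.symm, hl⟩)
    · rintro (rfl | h | h)
      · simp
      · exact h.le
      · exact h.1.ge
  rw [hsplit, Finset.sum_insert (by simp), Finset.sum_union]
  · have key : ∑ c : LTSeries α with a < c.head, (-1) ^ c.length * f c.last =
        -∑ c : LTSeries α with c.head = a ∧ c.length ≠ 0, (-1) ^ c.length * f c.last := by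
      rw [← Finset.sum_neg_distrib]
      refine Finset.sum_bij' (fun c hc => RelSeries.cons c a (by simpa using hc))
        (fun c hc => RelSeries.tail c (by simp at hc; exact hc.2)) ?_ ?_ ?_ ?_ ?_
      · intro c hc
        simp
      · intro c hc
        simp only [Finset.mem_filter, Finset.mem_univ, true_and] at hc ⊢
        obtain ⟨rfl, h⟩ := hc
        rw [RelSeries.head_tail, ← RelSeries.apply_zero]
        refine c.strictMono ?_
        rw [Fin.lt_def, Fin.val_zero, Fin.val_one', Nat.mod_eq_of_lt (by omega)]
        exact one_pos
      · intro c hc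
        exact RelSeries.tail_cons _ _ _
      · intro c hc
        simp only [Finset.mem_filter, Finset.mem_univ, true_and] at hc
        obtain ⟨rfl, h⟩ := hc
        exact RelSeries.cons_self_tail h
      · intro c hc
        simp [pow_succ]
    rw [key]
    simp
  · rw [Finset.disjoint_filter]
    rintro c - h h'
    exact h.ne' h'.1

/-! ### Multiplicities as dimensions of isotypic subspaces -/

/-- The averaging operator is a projection onto the invariants, and the trace of a projection is its
rank. -/
theorem Representation.card_inv_mul_sum_character {H V : Type*} [Group H] [Fintype H]
    [AddCommGroup V] [Module ℂ V] [FiniteDimensional ℂ V] (X : Representation ℂ H V) :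
    (Fintype.card H : ℂ)⁻¹ * ∑ h, X.character h = Module.finrank ℂ X.invariants := by
  have : Invertible (Fintype.card H : ℂ) :=
    invertibleOfNonzero (by simp)
  rw [← X.isProj_averageMap.trace, Representation.averageMap, GroupAlgebra.average]
  simp [Representation.character, map_sum, Representation.asAlgebraHom]

namespace LinPair

variable {G : Type*} [Group G] {V : Type*} [AddCommGroup V] [Module ℂ V]

/-- The `φ`-isotypic subspace of a representation, for a pair `(H, φ)`. -/
def isotypic (X : Representation ℂ G V) (P : LinPair G) : Submodule ℂ V where
  carrier := {v | ∀ h : P.grp, X h v = (P.lin h : ℂ) • v}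
  zero_mem' := by simp
  add_mem' := fun hv hw h => by rw [map_add, hv h, hw h, smul_add]
  smul_mem' := fun c v hv h => by rw [map_smul, hv h, smul_comm]

theorem mem_isotypic {X : Representation ℂ G V} {P : LinPair G} {v : V} :
    v ∈ P.isotypic X ↔ ∀ h : P.grp, X h v = (P.lin h : ℂ) • v :=
  Iff.rfl

theorem norm_lin [Finite G] (P : LinPair G) (h : P.grp) : ‖(P.lin h : ℂ)‖ = 1 := by
  refine Complex.norm_eq_one_of_pow_eq_one (n := Nat.card P.grp) ?_ Nat.card_pos.ne'
  rw [← Units.val_pow_eq_pow_val, ← map_pow, pow_card_eq_one', map_one, Units.val_one]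

theorem conj_lin [Finite G] (P : LinPair G) (h : P.grp) :
    (starRingEnd ℂ) (P.lin h : ℂ) = ((P.lin h)⁻¹ : ℂˣ) := by
  rw [Units.val_inv_eq_inv_val, Complex.inv_eq_conj (P.norm_lin h)]

theorem mult_character [Finite G] [FiniteDimensional ℂ V] (X : Representation ℂ G V)
    (P : LinPair G) : P.mult X.character = Module.finrank ℂ (P.isotypic X) := by
  have := Fintype.ofFinite P.grp
  -- Twisting by φ⁻¹ turns the φ-isotypic subspace into the space of invariants.
  let Y : Representation ℂ P.grp V :=
    { toFun := fun h => (((P.lin h)⁻¹ : ℂˣ) : ℂ) • X h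
      map_one' := by simp
      map_mul' := fun a b => by
        rw [Subgroup.coe_mul, map_mul, map_mul, mul_inv, Units.val_mul, smul_mul_smul_comm] }
  have hY : ∀ h : P.grp, Y h = (((P.lin h)⁻¹ : ℂˣ) : ℂ) • X h := fun _ => rfl
  have hinv : Y.invariants = P.isotypic X := by
    ext v
    rw [Representation.mem_invariants, mem_isotypic]
    refine forall_congr' fun h => ?_
    rw [hY, LinearMap.smul_apply, Units.val_inv_eq_inv_val, inv_smul_eq_iff₀ (Units.ne_zero _)]
  rw [← hinv, ← Y.card_inv_mul_sum_character, mult, schurInner, finsum_eq_sum_of_fintype,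
    Nat.card_eq_fintype_card]
  congr 1
  refine Finset.sum_congr rfl fun h _ => ?_
  rw [conj_lin, Representation.character, Representation.character, hY, map_smul, smul_eq_mul,
    mul_comm]

theorem mult_character_nonneg [Finite G] [FiniteDimensional ℂ V] (X : Representation ℂ G V)
    (P : LinPair G) : 0 ≤ P.mult X.character := by
  rw [mult_character]
  exact Nat.cast_nonneg _

theorem mult_character_pos_iff [Finite G] [FiniteDimensional ℂ V] (X : Representation ℂ G V)
    (P : LinPair G) : 0 < P.mult X.character ↔ ∃ v ∈ P.isotypic X, v ≠ 0 := by
  rw [mult_character, Nat.cast_pos, Module.finrank_pos_iff, Submodule.nontrivial_iff_ne_bot,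
    Submodule.ne_bot_iff]

end LinPair

/-! ### Fourier inversion on cyclic groups -/

theorem CommGroup.sum_monoidHom_apply {A : Type*} [CommGroup A] [Finite A] [DecidableEq A]
    [Fintype (A →* ℂˣ)] (a : A) :
    ∑ ψ : A →* ℂˣ, (ψ a : ℂ) = if a = 1 then (Nat.card A : ℂ) else 0 := by
  have : NeZero (Monoid.exponent A) := ⟨Monoid.exponent_ne_zero_of_finite⟩
  split_ifs with h
  · subst h
    simp [← CommGroup.card_monoidHom_of_hasEnoughRootsOfUnity A ℂ]
  -- Translation by a character θ with θ(a) ≠ 1 multiplies the sum by θ(a) while only permuting its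
  -- terms.
  · obtain ⟨θ, hθ⟩ := CommGroup.exists_apply_ne_one_of_hasEnoughRootsOfUnity A ℂ h
    have := Fintype.sum_equiv (Equiv.mulLeft θ) (fun ψ => ((θ * ψ : A →* ℂˣ) a : ℂ))
      (fun ψ => (ψ a : ℂ)) (fun _ => rfl)
    simp only [MonoidHom.mul_apply, Units.val_mul, ← Finset.mul_sum] at this
    by_contra hne
    exact hθ (Units.ext (mul_right_cancel₀ hne (by rw [this, Units.val_one, one_mul])))

/-- Fourier inversion on the cyclic subgroup generated by `x`. -/
theorem sum_mult_zpowers {G : Type*} [Group G] [Finite G]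
    [∀ H : Subgroup G, Fintype (H →* ℂˣ)] (χ : G → ℂ) (x : G) (y : Subgroup.zpowers x) :
    ∑ ψ : Subgroup.zpowers x →* ℂˣ, (ψ y : ℂ) * LinPair.mult χ ⟨Subgroup.zpowers x, ψ⟩ =
      χ y := by
  classical
  have := Fintype.ofFinite (Subgroup.zpowers x)
  have hc : (Nat.card (Subgroup.zpowers x) : ℂ) ≠ 0 := by
    exact_mod_cast Nat.card_pos.ne'
  have h : ∀ (ψ : Subgroup.zpowers x →* ℂˣ),
      (ψ y : ℂ) * LinPair.mult χ ⟨Subgroup.zpowers x, ψ⟩ =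
        ∑ h : Subgroup.zpowers x, (Nat.card (Subgroup.zpowers x) : ℂ)⁻¹ *
          (χ h * (ψ (y * h⁻¹) : ℂ)) := fun ψ => by
    rw [LinPair.mult, schurInner, finsum_eq_sum_of_fintype, ← Finset.mul_sum, mul_left_comm,
      Finset.mul_sum]
    congr 1
    refine Finset.sum_congr rfl fun h _ => ?_
    have := LinPair.conj_lin ⟨Subgroup.zpowers x, ψ⟩ h
    dsimp only at this ⊢
    rw [this, map_mul, map_inv, Units.val_mul]
    ring
  have orth : ∀ a : Subgroup.zpowers x, ∑ ψ : Subgroup.zpowers x →* ℂˣ, (ψ a : ℂ) =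
      if a = 1 then (Nat.card (Subgroup.zpowers x) : ℂ) else 0 := fun a =>
    letI : CommGroup (Subgroup.zpowers x) := IsCyclic.commGroup
    CommGroup.sum_monoidHom_apply a
  rw [Finset.sum_congr rfl fun ψ _ => h ψ, Finset.sum_comm, Finset.sum_eq_single y]
  · rw [← Finset.mul_sum, ← Finset.mul_sum, orth, if_pos (by simp)]
    field_simp
  · intro h _ hy
    rw [← Finset.mul_sum, ← Finset.mul_sum, orth,
      if_neg (by rw [mul_inv_eq_one]; exact hy.symm)]
    simp
  · simp

/-! ### Arithmetic of the exponents and inclusion-exclusion -/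

theorem Nat.factorization_prod_prime_pow {s : Finset ℕ} (hs : ∀ p ∈ s, p.Prime) (f : ℕ → ℕ)
    (q : ℕ) : (∏ p ∈ s, p ^ f p).factorization q = if q ∈ s then f q else 0 := by
  classical
  rw [Nat.factorization_prod_apply fun p hp => pow_ne_zero _ (hs p hp).ne_zero,
    Finset.sum_congr rfl fun p hp => by rw [(hs p hp).factorization_pow, Finsupp.single_apply]]
  simp

theorem factorization_div_prod_primeFactors (n q : ℕ) :
    (n / ∏ p ∈ n.primeFactors, p).factorization q = n.factorization q - 1 := by
  rw [Nat.factorization_div (Nat.prod_primeFactors_dvd n), Finsupp.tsub_apply]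
  have := Nat.factorization_prod_prime_pow (s := n.primeFactors)
    (fun p hp => Nat.prime_of_mem_primeFactors hp) (fun _ => 1) q
  simp only [pow_one] at this
  rw [this]
  split_ifs with h
  · rfl
  · rw [← Nat.support_factorization, Finsupp.notMem_support_iff] at h
    rw [h, Nat.sub_zero, Nat.zero_sub]

/-- Primes outside ρ impose no condition, since there n(ρ) has the full part of exp(G); at p ∈ ρ
only the p-part of n / ∏ p remains. -/
theorem dvd_adamsExponent_iff {G : Type*} [Group G] [Finite G] {n d : ℕ}
    (hd : d ∣ Monoid.exponent G) (ρ : Finset ℕ) :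
    d ∣ adamsExponent G n ρ ↔ ∀ p ∈ ρ, d.factorization p ≤ n.factorization p - 1 := by
  classical
  have he : Monoid.exponent G ≠ 0 := Monoid.exponent_ne_zero_of_finite
  have hd0 : d ≠ 0 := ne_zero_of_dvd_ne_zero he hd
  have hpp : ∀ q, (primePart ρ (n / ∏ p ∈ n.primeFactors, p)).factorization q =
      if q ∈ ρ then n.factorization q - 1 else 0 := fun q => by
    rw [primePart, Nat.factorization_prod_prime_pow, factorization_div_prod_primeFactors]
    · by_cases hq : q ∈ ρ
      · simp only [Finset.mem_inter, hq, and_true, if_true, ite_eq_left_iff]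
        rw [← Nat.support_factorization, Finsupp.notMem_support_iff,
          factorization_div_prod_primeFactors]
        exact fun h => h.symm
      · simp [hq]
    · exact fun p hp => Nat.prime_of_mem_primeFactors (Finset.mem_inter.1 hp).1
  have hcp : ∀ q, (primeCoPart ρ (Monoid.exponent G)).factorization q =
      if q ∈ ρ then 0 else (Monoid.exponent G).factorization q := fun q => by
    rw [primeCoPart, Nat.factorization_prod_prime_pow]
    · by_cases hq : q ∈ ρ
      · simp [hq]
      · simp only [Finset.mem_sdiff, hq, not_false_eq_true, and_true, if_false, ite_eq_left_iff]
        rw [← Nat.support_factorization, Finsupp.notMem_support_iff]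
        exact fun h => h.symm
    · exact fun p hp => Nat.prime_of_mem_primeFactors (Finset.mem_sdiff.1 hp).1
  have h1 : primePart ρ (n / ∏ p ∈ n.primeFactors, p) ≠ 0 :=
    Finset.prod_ne_zero_iff.2 fun p hp =>
      pow_ne_zero _ (Nat.prime_of_mem_primeFactors (Finset.mem_inter.1 hp).1).ne_zero
  have h2 : primeCoPart ρ (Monoid.exponent G) ≠ 0 :=
    Finset.prod_ne_zero_iff.2 fun p hp =>
      pow_ne_zero _ (Nat.prime_of_mem_primeFactors (Finset.mem_sdiff.1 hp).1).ne_zero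
  rw [adamsExponent, ← Nat.factorization_le_iff_dvd hd0 (mul_ne_zero h2 h1),
    Nat.factorization_mul h2 h1, Finsupp.le_def]
  simp only [Finsupp.add_apply, hpp, hcp]
  constructor
  · intro h p hp
    simpa [hp] using h p
  · intro h p
    by_cases hp : p ∈ ρ
    · simpa [hp] using h p hp
    · simpa [hp] using (Nat.factorization_le_iff_dvd hd0 he).2 hd p

/-- A multiple of `e_{p'}` whose `p`-part is `n_p / p`. -/
def primeExponent (e n p : ℕ) : ℕ := ordCompl[p] e * p ^ (n.factorization p - 1)

/-- The summand at p contains the full q-part of `e` for every prime q ≠ p, so divisibility by the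
q-part of `d` is decided by the summand at q alone. The condition matches `dvd_adamsExponent_iff`,
but this exponent is additive in ρ; the units `t p` leave room for a choice of signs. -/
theorem dvd_sum_primeExponent_iff {e n d : ℕ} (he : e ≠ 0) (hd : d ∣ e) {ρ : Finset ℕ}
    (hρ : ρ ⊆ n.primeFactors) {t : ℕ → ℕ} (ht : ∀ p, (t p).Coprime e) :
    d ∣ ∑ p ∈ ρ, t p * primeExponent e n p ↔
      ∀ p ∈ ρ, d.factorization p ≤ n.factorization p - 1 := by
  classical
  have hd0 : d ≠ 0 := ne_zero_of_dvd_ne_zero he hd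
  have hdvd : ∀ m, d ∣ m ↔ ∀ q, q.Prime → q ^ d.factorization q ∣ m := fun m => by
    refine ⟨fun h q _ => (Nat.ordProj_dvd d q).trans h, fun h => ?_⟩
    rw [Nat.dvd_iff_prime_pow_dvd_dvd]
    exact fun p k hp hk => (pow_dvd_pow p ((hp.pow_dvd_iff_le_factorization hd0).1 hk)).trans
      (h p hp)
  have hne : ∀ p q, q.Prime → p.Prime → p ≠ q →
      q ^ d.factorization q ∣ t p * primeExponent e n p := fun p q hq hp hpq => by
    refine Dvd.dvd.mul_left (Dvd.dvd.mul_right ?_ _) _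
    have h1 : q ^ d.factorization q ∣ ordProj[p] e * ordCompl[p] e := by
      rw [Nat.ordProj_mul_ordCompl_eq_self]
      exact (Nat.ordProj_dvd d q).trans hd
    exact (((Nat.coprime_primes hq hp).2 hpq.symm).pow _ _).dvd_of_dvd_mul_left h1
  have hself : ∀ q, q.Prime → (q ^ d.factorization q ∣ t q * primeExponent e n q ↔
      d.factorization q ≤ n.factorization q - 1) := fun q hq => by
    have h1 : (q ^ d.factorization q).Coprime (t q) :=
      ((ht q).coprime_dvd_right ((Nat.ordProj_dvd d q).trans hd)).symm
    have h2 : (q ^ d.factorization q).Coprime (ordCompl[q] e) :=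
      (Nat.coprime_ordCompl hq he).pow_left _
    rw [h1.dvd_mul_left, primeExponent, h2.dvd_mul_left, Nat.pow_dvd_pow_iff_le_right hq.one_lt]
  rw [hdvd]
  constructor
  · intro h q hq
    have hqp := Nat.prime_of_mem_primeFactors (hρ hq)
    have := h q hqp
    rw [← Finset.add_sum_erase _ _ hq, Nat.dvd_add_left, hself q hqp] at this
    · exact this
    · exact Finset.dvd_sum fun p hp => hne p q hqp
        (Nat.prime_of_mem_primeFactors (hρ (Finset.mem_of_mem_erase hp))) (Finset.ne_of_mem_erase hp)
  · intro h q hqp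
    refine Finset.dvd_sum fun p hp => ?_
    have hpp := Nat.prime_of_mem_primeFactors (hρ hp)
    by_cases hpq : p = q
    · subst hpq
      exact (hself p hpp).2 (h p hp)
    · exact hne p q hqp hpp hpq

theorem dvd_iff_forall_not_factorization_le {n d : ℕ} (hn : n ≠ 0) (hd : d ≠ 0) :
    n ∣ d ↔ ∀ p ∈ n.primeFactors, ¬ d.factorization p ≤ n.factorization p - 1 := by
  rw [← Nat.factorization_le_iff_dvd hn hd, Finsupp.le_def]
  constructor
  · intro h p hp
    have := h p
    rw [← Nat.support_factorization, Finsupp.mem_support_iff] at hp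
    omega
  · intro h p
    by_cases hp : p ∈ n.primeFactors
    · have := h p hp
      omega
    · rw [← Nat.support_factorization, Finsupp.notMem_support_iff] at hp
      omega

/-- Inclusion-exclusion, by expanding the product of 1 - [P i] over `s`. -/
theorem Finset.sum_powerset_neg_one_pow_ite {ι R : Type*} [CommRing R] (s : Finset ι)
    (P : ι → Prop) [DecidablePred P] :
    ∑ t ∈ s.powerset, (-1 : R) ^ t.card * (if ∀ i ∈ t, P i then 1 else 0) =
      if ∀ i ∈ s, ¬ P i then 1 else 0 := by
  classical
  have h := Finset.prod_sub (fun _ => (1 : R)) (fun i => if P i then 1 else 0) s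
  simp only [Finset.prod_ite_zero, Finset.prod_const_one, mul_one] at h
  rw [← h]
  trans ∏ i ∈ s, if ¬ P i then (1 : R) else 0
  · exact Finset.prod_congr rfl fun i _ => by split_ifs <;> simp
  · rw [Finset.prod_ite_zero, Finset.prod_const_one]

/-! ### Adams operations and the canonical Brauer induction formula -/

namespace LinPair

variable {G : Type*} [Group G]

theorem orderOf_dvd_exponent (P : LinPair G) : orderOf P.lin ∣ Monoid.exponent G := by
  refine orderOf_dvd_of_pow_eq_one (MonoidHom.ext fun h => ?_)
  rw [MonoidHom.pow_apply, ← map_pow, MonoidHom.one_apply]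
  have : h ^ Monoid.exponent G = 1 := Subtype.ext (by simp [Monoid.pow_exponent_eq_one])
  rw [this, map_one]

theorem sum_lin_pow [Fintype G] (P : LinPair G) (k : ℕ) [Fintype P.grp] :
    ∑ h : P.grp, (P.lin h : ℂ) ^ k =
      if orderOf P.lin ∣ k then (Nat.card P.grp : ℂ) else 0 := by
  classical
  have h := sum_hom_units ((Units.coeHom ℂ).comp (P.lin ^ k))
  have e : (Units.coeHom ℂ).comp (P.lin ^ k) = 1 ↔ orderOf P.lin ∣ k := by
    rw [orderOf_dvd_iff_pow_eq_one]
    constructor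
    · intro h
      ext x
      exact DFunLike.congr_fun h x
    · rintro h
      rw [h]
      rfl
  simp only [e] at h
  simpa [Nat.card_eq_fintype_card] using h

end LinPair

open LinPair

section

variable {G : Type*} [Group G] [Fintype G]

theorem schurInner_one_right (α : G → ℂ) :
    schurInner α (fun _ => 1) = (Nat.card G : ℂ)⁻¹ * ∑ g, α g := by
  simp [schurInner, finsum_eq_sum_of_fintype]

open Classical in
/-- A value of `χ` as an alternating sum over the chains of `ℳ(G)` whose head contains `x`. -/
theorem apply_pow_eq_sum_chains [Fintype (LTSeries (LinPair G))] (χ : G → ℂ) (x : G) (k : ℕ) :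
    χ (x ^ k) = ∑ c : LTSeries (LinPair G), (-1) ^ c.length * c.last.mult χ *
      (if hx : x ∈ c.head.grp then (c.head.lin ⟨x, hx⟩ : ℂ) ^ k else 0) := by
  have (H : Subgroup G) : Fintype (H →* ℂˣ) := Fintype.ofFinite _
  have h := sum_mult_zpowers χ x ⟨x ^ k, Subgroup.npow_mem_zpowers x k⟩
  dsimp only at h
  rw [← h]
  have h2 : ∀ ψ : Subgroup.zpowers x →* ℂˣ, LinPair.mult χ ⟨Subgroup.zpowers x, ψ⟩ =
      ∑ c : LTSeries (LinPair G), if (⟨Subgroup.zpowers x, ψ⟩ : LinPair G) ≤ c.head then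
        (-1) ^ c.length * c.last.mult χ else 0 := fun ψ => by
    rw [← Finset.sum_filter]
    exact (LTSeries.sum_neg_one_pow_length_of_le_head (α := LinPair G) _ (LinPair.mult χ)).symm
  rw [Finset.sum_congr rfl fun ψ _ => by rw [h2 ψ, Finset.mul_sum], Finset.sum_comm]
  refine Finset.sum_congr rfl fun c _ => ?_
  by_cases hx : x ∈ c.head.grp
  · have hK : Subgroup.zpowers x ≤ c.head.grp := by rwa [Subgroup.zpowers_le]
    -- For a fixed chain, the only pair on ⟨x⟩ below the head is the restriction of the head's
    -- character.
    rw [Finset.sum_eq_single (c.head.lin.comp (Subgroup.inclusion hK)), if_pos ⟨hK, rfl⟩,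
      dif_pos hx, mul_comm]
    · rw [← Units.val_pow_eq_pow_val, ← map_pow]
      rfl
    · rintro ψ - hψ
      rw [if_neg, mul_zero]
      rintro ⟨_, h⟩
      exact hψ h
    · simp
  · rw [dif_neg hx, mul_zero]
    refine Finset.sum_eq_zero fun ψ _ => ?_
    rw [if_neg, mul_zero]
    rintro ⟨h, -⟩
    exact hx (h (Subgroup.mem_zpowers x))

/-- The multiplicity of `1_G` in `Ψᵏ(χ)` in terms of the chains in the canonical Brauer induction
formula. -/
theorem schurInner_adamsOp_one [Fintype (LTSeries (LinPair G))] (χ : G → ℂ) (k : ℕ) :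
    schurInner (adamsOp k χ) (fun _ => 1) =
      (Nat.card G : ℂ)⁻¹ * ∑ c : LTSeries (LinPair G),
        ((-1) ^ c.length * (Nat.card c.head.grp : ℂ) * c.last.mult χ) *
          if orderOf c.head.lin ∣ k then 1 else 0 := by
  classical
  rw [schurInner_one_right]
  congr 1
  simp only [adamsOp, apply_pow_eq_sum_chains χ _ k]
  rw [Finset.sum_comm]
  refine Finset.sum_congr rfl fun c _ => ?_
  have : Fintype c.head.grp := Fintype.ofFinite _
  rw [← Finset.mul_sum]
  have h : ∑ x : G, (if hx : x ∈ c.head.grp then (c.head.lin ⟨x, hx⟩ : ℂ) ^ k else 0) =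
      ∑ h : c.head.grp, (c.head.lin h : ℂ) ^ k := by
    rw [← Finset.sum_subset (Finset.filter_subset (· ∈ c.head.grp) Finset.univ),
      Finset.sum_subtype (p := (· ∈ c.head.grp)) _ (by simp)]
    · exact Finset.sum_congr rfl fun h _ => dif_pos h.2
    · intro x _ hx
      exact dif_neg (by simpa using hx)
  rw [h, sum_lin_pow]
  split_ifs <;> ring

/-- In the chain formula `k` enters only through the conditions o(φ₀) ∣ k, and each o(φ₀) divides
exp(G). -/
theorem schurInner_adamsOp_congr (χ : G → ℂ) {k l : ℕ}
    (h : ∀ d, d ∣ Monoid.exponent G → (d ∣ k ↔ d ∣ l)) :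
    schurInner (adamsOp k χ) (fun _ => 1) = schurInner (adamsOp l χ) (fun _ => 1) := by
  have := Fintype.ofFinite (LTSeries (LinPair G))
  simp only [schurInner_adamsOp_one, h _ (orderOf_dvd_exponent _)]

theorem brauerSum_eq [Fintype (LTSeries (LinPair G))] (χ : G → ℂ) (n : ℕ) :
    brauerSum χ n = (Nat.card G : ℂ)⁻¹ * ∑ c : LTSeries (LinPair G),
      ((-1) ^ c.length * (Nat.card c.head.grp : ℂ) * c.last.mult χ) *
        if n ∣ orderOf c.head.lin then 1 else 0 := by
  classical
  have := Fintype.ofFinite (Orbit G)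
  have h : ∀ q : Orbit G, (∑ᶠ (_ : n ∣ q.order), brauerCoeff χ q) = (Nat.card G : ℂ)⁻¹ *
      ∑ c : LTSeries (LinPair G), if c.head.orbit = q then
        ((-1) ^ c.length * (Nat.card c.head.grp : ℂ) * c.last.mult χ) *
          (if n ∣ orderOf c.head.lin then 1 else 0) else 0 := fun q => by
    rw [finsum_eq_if, brauerCoeff, finsum_eq_sum_of_fintype, ← mul_ite_zero]
    simp only [finsum_eq_if]
    split_ifs with hq
    · congr 1
      refine Finset.sum_congr rfl fun c _ => ?_
      split_ifs with h1 h2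
      · rw [mul_one]
      · subst h1; exact absurd hq h2
      · rfl
    · rw [Finset.sum_eq_zero]
      intro c _
      split_ifs with h1 h2
      · subst h1; exact absurd h2 hq
      · rw [mul_zero]
      · rfl
  rw [brauerSum, finsum_eq_sum_of_fintype, Finset.sum_congr rfl fun q _ => h q, ← Finset.mul_sum,
    Finset.sum_comm]
  simp

theorem schurInner_alternatingAdams (χ : G → ℂ) (n : ℕ) :
    schurInner (alternatingAdams χ n) (fun _ => 1) = ∑ ρ ∈ n.primeFactors.powerset,
      (-1) ^ ρ.card * schurInner (adamsOp (adamsExponent G n ρ) χ) (fun _ => 1) := by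
  simp only [schurInner_one_right, alternatingAdams]
  rw [Finset.sum_comm, Finset.mul_sum]
  refine Finset.sum_congr rfl fun ρ _ => ?_
  rw [← Finset.mul_sum, mul_left_comm]

theorem brauerSum_eq_schurInner_alternatingAdams (χ : G → ℂ) {n : ℕ} (hn : n ≠ 0) :
    brauerSum χ n = schurInner (alternatingAdams χ n) (fun _ => 1) := by
  classical
  have := Fintype.ofFinite (LTSeries (LinPair G))
  simp only [schurInner_alternatingAdams, schurInner_adamsOp_one, brauerSum_eq, Finset.mul_sum]
  rw [Finset.sum_comm]
  refine Finset.sum_congr rfl fun c _ => ?_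
  have hd := orderOf_dvd_exponent c.head
  have hd0 : orderOf c.head.lin ≠ 0 :=
    ne_zero_of_dvd_ne_zero Monoid.exponent_ne_zero_of_finite hd
  simp only [dvd_adamsExponent_iff hd, dvd_iff_forall_not_factorization_le hn hd0]
  rw [← Finset.sum_powerset_neg_one_pow_ite, Finset.mul_sum, Finset.mul_sum]
  exact Finset.sum_congr rfl fun ρ _ => by ring

end

/-! ### Factorization and positivity of the alternating sum -/

section

variable {G : Type*} [Group G] [Fintype G]

/-- With the exponents `n(ρ)` replaced by equivalent ones, the alternating sum factors at each
element of the group. -/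
theorem schurInner_alternatingAdams_eq_sum_prod [∀ H : Subgroup G, Fintype (H →* ℂˣ)]
    (χ : G → ℂ) (n : ℕ) {t : ℕ → ℕ} (ht : ∀ p, (t p).Coprime (Monoid.exponent G)) :
    schurInner (alternatingAdams χ n) (fun _ => 1) = (Nat.card G : ℂ)⁻¹ *
      ∑ x : G, ∑ ψ : Subgroup.zpowers x →* ℂˣ, LinPair.mult χ ⟨Subgroup.zpowers x, ψ⟩ *
        ∏ p ∈ n.primeFactors, (1 - (ψ ⟨x, Subgroup.mem_zpowers x⟩ : ℂ) ^
          (t p * primeExponent (Monoid.exponent G) n p)) := by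
  classical
  have h1 : ∀ ρ ∈ n.primeFactors.powerset,
      schurInner (adamsOp (adamsExponent G n ρ) χ) (fun _ => 1) =
        schurInner (adamsOp (∑ p ∈ ρ, t p * primeExponent (Monoid.exponent G) n p) χ)
          (fun _ => 1) := fun ρ hρ => schurInner_adamsOp_congr χ fun d hd => by
    rw [dvd_adamsExponent_iff hd, dvd_sum_primeExponent_iff Monoid.exponent_ne_zero_of_finite hd
      (Finset.mem_powerset.1 hρ) ht]
  have h2 : ∀ (x : G) (k : ℕ), χ (x ^ k) = ∑ ψ : Subgroup.zpowers x →* ℂˣ,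
      (ψ ⟨x, Subgroup.mem_zpowers x⟩ : ℂ) ^ k * LinPair.mult χ ⟨Subgroup.zpowers x, ψ⟩ :=
    fun x k => by
      have h := sum_mult_zpowers χ x (⟨x, Subgroup.mem_zpowers x⟩ ^ k)
      simp only [map_pow, Units.val_pow_eq_pow_val] at h
      exact h.symm
  rw [schurInner_alternatingAdams, Finset.sum_congr rfl fun ρ hρ => by rw [h1 ρ hρ]]
  simp only [schurInner_one_right, adamsOp, mul_left_comm _ ((Nat.card G : ℂ)⁻¹)]
  rw [← Finset.mul_sum, Finset.sum_congr rfl fun ρ _ => Finset.mul_sum _ _ _, Finset.sum_comm]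
  congr 1
  refine Finset.sum_congr rfl fun x _ => ?_
  simp only [h2, Finset.mul_sum]
  rw [Finset.sum_comm]
  refine Finset.sum_congr rfl fun ψ _ => ?_
  rw [Finset.prod_sub, Finset.mul_sum]
  refine Finset.sum_congr rfl fun ρ _ => ?_
  rw [Finset.prod_pow_eq_pow_sum, Finset.prod_const_one]
  ring

/-- Averaging over the choices of sign gives a sum of nonnegative terms. -/
theorem two_pow_mul_schurInner_alternatingAdams [∀ H : Subgroup G, Fintype (H →* ℂˣ)]
    (χ : G → ℂ) (n : ℕ) :
    2 ^ n.primeFactors.card * schurInner (alternatingAdams χ n) (fun _ => 1) =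
      (Nat.card G : ℂ)⁻¹ *
      ∑ x : G, ∑ ψ : Subgroup.zpowers x →* ℂˣ, LinPair.mult χ ⟨Subgroup.zpowers x, ψ⟩ *
        ((∏ p ∈ n.primeFactors, ‖1 - (ψ ⟨x, Subgroup.mem_zpowers x⟩ : ℂ) ^
          primeExponent (Monoid.exponent G) n p‖ ^ 2 : ℝ) : ℂ) := by
  classical
  have he : Monoid.exponent G ≠ 0 := Monoid.exponent_ne_zero_of_finite
  -- The inner product does not depend on `t`, so a different `t` may be used for each σ: exponent 1
  -- on σ and exp(G) - 1, which acts as -1, off σ.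
  have hsum : ∑ _σ ∈ n.primeFactors.powerset,
      schurInner (alternatingAdams χ n) (fun _ => 1) =
      2 ^ n.primeFactors.card * schurInner (alternatingAdams χ n) (fun _ => 1) := by
    rw [Finset.sum_const, Finset.card_powerset, nsmul_eq_mul]
    push_cast
    rfl
  rw [← hsum, Finset.sum_congr rfl fun σ _ => schurInner_alternatingAdams_eq_sum_prod χ n
    (t := fun p => if p ∈ σ then 1 else Monoid.exponent G - 1) fun p => by
      split_ifs
      · exact Nat.coprime_one_left _
      · exact (Nat.coprime_self_sub_left (Nat.one_le_iff_ne_zero.2 he)).2 (Nat.coprime_one_left _),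
    ← Finset.mul_sum, Finset.sum_comm]
  congr 1
  refine Finset.sum_congr rfl fun x _ => ?_
  rw [Finset.sum_comm]
  refine Finset.sum_congr rfl fun ψ _ => ?_
  rw [← Finset.mul_sum]
  congr 1
  have hnorm : ‖(ψ ⟨x, Subgroup.mem_zpowers x⟩ : ℂ)‖ = 1 :=
    LinPair.norm_lin ⟨Subgroup.zpowers x, ψ⟩ _
  have hpow : (ψ ⟨x, Subgroup.mem_zpowers x⟩ : ℂ) ^ Monoid.exponent G = 1 := by
    rw [← Units.val_pow_eq_pow_val, ← map_pow]
    have : (⟨x, Subgroup.mem_zpowers x⟩ : Subgroup.zpowers x) ^ Monoid.exponent G = 1 :=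
      Subtype.ext (by simp [Monoid.pow_exponent_eq_one])
    rw [this, map_one, Units.val_one]
  generalize (ψ ⟨x, Subgroup.mem_zpowers x⟩ : ℂ) = z at hnorm hpow
  have hz : z ≠ 0 := norm_ne_zero_iff.1 (by rw [hnorm]; exact one_ne_zero)
  have hinv : z ^ (Monoid.exponent G - 1) = z⁻¹ := by
    refine eq_inv_of_mul_eq_one_left ?_
    rw [← pow_succ, Nat.sub_add_cancel (Nat.one_le_iff_ne_zero.2 he),
      hpow]
  -- The sum over σ is the expansion of this product. As |z| = 1, with w = z^(m_p) each factor is 2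
  -- - w - w̄ = |1 - w|².
  trans ∏ p ∈ n.primeFactors, ((1 - z ^ primeExponent (Monoid.exponent G) n p) +
    (1 - (z⁻¹) ^ primeExponent (Monoid.exponent G) n p))
  · rw [Finset.prod_add]
    refine Finset.sum_congr rfl fun σ hσ => ?_
    rw [← Finset.prod_sdiff (Finset.mem_powerset.1 hσ), mul_comm]
    congr 1
    · refine Finset.prod_congr rfl fun p hp => ?_
      rw [if_pos hp, one_mul]
    · refine Finset.prod_congr rfl fun p hp => ?_
      rw [if_neg (Finset.mem_sdiff.1 hp).2, pow_mul, hinv]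
  · rw [Complex.ofReal_prod]
    refine Finset.prod_congr rfl fun p _ => ?_
    rw [Complex.ofReal_pow, ← Complex.mul_conj', map_sub, map_one, map_pow,
      ← Complex.inv_eq_conj hnorm, inv_pow]
    have := pow_ne_zero (primeExponent (Monoid.exponent G) n p) hz
    field_simp
    ring

/-! ### Eigenvalues and their orders -/

theorem dvd_orderOf_iff_forall_pow_primeExponent_ne_one {M : Type*} [Monoid M] {z : M} {e n : ℕ}
    (he : e ≠ 0) (hn : n ≠ 0) (hz : z ^ e = 1) :
    n ∣ orderOf z ↔ ∀ p ∈ n.primeFactors, z ^ primeExponent e n p ≠ 1 := by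
  have hd := orderOf_dvd_of_pow_eq_one hz
  rw [dvd_iff_forall_not_factorization_le hn (ne_zero_of_dvd_ne_zero he hd)]
  refine forall₂_congr fun p hp => not_congr ?_
  rw [← orderOf_dvd_iff_pow_eq_one]
  have := dvd_sum_primeExponent_iff he hd (Finset.singleton_subset_iff.2 hp) (t := fun _ => 1)
    (fun _ => Nat.coprime_one_left _)
  simpa using this.symm

variable {V : Type*} [AddCommGroup V] [Module ℂ V]

theorem hasEigenvalue_of_mem_isotypic {G : Type*} [Group G] {X : Representation ℂ G V} {P : LinPair G} {v : V}
    (hv : v ∈ P.isotypic X) (hv0 : v ≠ 0) (h : P.grp) :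
    Module.End.HasEigenvalue (X h) (P.lin h : ℂ) :=
  Module.End.hasEigenvalue_of_hasEigenvector ⟨Module.End.mem_eigenspace_iff.2 (hv h), hv0⟩

theorem exists_isotypic_zpowers_of_hasEigenvalue {X : Representation ℂ G V} {x : G} {ζ : ℂ}
    (h : Module.End.HasEigenvalue (X x) ζ) :
    ∃ ψ : Subgroup.zpowers x →* ℂˣ, (ψ ⟨x, Subgroup.mem_zpowers x⟩ : ℂ) = ζ ∧
      ∃ v ∈ LinPair.isotypic X ⟨Subgroup.zpowers x, ψ⟩, v ≠ 0 := by
  obtain ⟨v, hv⟩ := h.exists_hasEigenvector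
  have hpow : ∀ k : ℕ, X (x ^ k) v = ζ ^ k • v := fun k => by
    induction k with
    | zero => simp
    | succ k ih => rw [pow_succ, map_mul, Module.End.mul_apply, hv.apply_eq_smul, map_smul, ih,
        smul_smul, pow_succ']
  have hζ : ζ ^ orderOf x = 1 := by
    have := hpow (orderOf x)
    rw [pow_orderOf_eq_one, map_one, Module.End.one_apply] at this
    by_contra hne
    have h0 : (ζ ^ orderOf x - 1) • v = 0 := by rw [sub_smul, one_smul, ← this, sub_self]
    exact (smul_ne_zero (sub_ne_zero.2 hne) hv.2) h0
  have hx : orderOf x ≠ 0 := (orderOf_pos x).ne'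
  -- Since ζ to the power o(x) is 1, sending x to ζ defines a character of ⟨x⟩, and the eigenvector
  -- is isotypic for it.
  let u : ℂˣ := Units.ofPowEqOne ζ (orderOf x) hζ hx
  have hu : orderOf u ∣ orderOf (⟨x, Subgroup.mem_zpowers x⟩ : Subgroup.zpowers x) := by
    rw [Subgroup.orderOf_mk]
    exact orderOf_dvd_of_pow_eq_one (Units.pow_ofPowEqOne hζ hx)
  have hg : ∀ y : Subgroup.zpowers x, y ∈ Subgroup.zpowers
      (⟨x, Subgroup.mem_zpowers x⟩ : Subgroup.zpowers x) := by
    rintro ⟨_, k, rfl⟩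
    exact ⟨k, rfl⟩
  refine ⟨monoidHomOfForallMemZpowers hg hu, ?_, v, ?_, hv.2⟩
  · rw [monoidHomOfForallMemZpowers_apply_gen]
    rfl
  · rintro ⟨y, hy⟩
    obtain ⟨k, rfl⟩ := mem_powers_iff_mem_zpowers.2 hy
    have e : (⟨x ^ k, hy⟩ : Subgroup.zpowers x) = ⟨x, Subgroup.mem_zpowers x⟩ ^ k := rfl
    change X (x ^ k) v = ((monoidHomOfForallMemZpowers hg hu ⟨x ^ k, hy⟩ : ℂˣ) : ℂ) • v
    rw [hpow, e, map_pow, monoidHomOfForallMemZpowers_apply_gen]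
    rfl

theorem exists_hasEigenvalue_orderOf_of_dvd {X : Representation ℂ G V} {x : G} {ζ : ℂ} {n : ℕ}
    (hζ : orderOf ζ ≠ 0) (h : Module.End.HasEigenvalue (X x) ζ) (hn : n ∣ orderOf ζ) :
    ∃ (y : G) (ξ : ℂ), Module.End.HasEigenvalue (X y) ξ ∧ orderOf ξ = n := by
  obtain ⟨k, hk⟩ := hn
  obtain ⟨ψ, rfl, v, hv, hv0⟩ := exists_isotypic_zpowers_of_hasEigenvalue h
  -- With o(ζ) = n k, the same vector is an eigenvector of xᵏ with eigenvalue ζᵏ, of order n.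
  refine ⟨_, _, hasEigenvalue_of_mem_isotypic hv hv0 (⟨x, Subgroup.mem_zpowers x⟩ ^ k), ?_⟩
  dsimp only
  rw [map_pow, Units.val_pow_eq_pow_val, orderOf_pow_of_dvd _ ⟨n, by rw [hk, mul_comm]⟩, hk]
  · exact Nat.mul_div_cancel _ (Nat.pos_of_ne_zero (right_ne_zero_of_mul (hk ▸ hζ)))
  · exact right_ne_zero_of_mul (hk ▸ hζ)

variable [FiniteDimensional ℂ V]

theorem schurInner_alternatingAdams_pos_iff (X : Representation ℂ G V) {n : ℕ} (hn : n ≠ 0) :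
    0 < schurInner (alternatingAdams X.character n) (fun _ => 1) ↔
      ∃ (x : G) (ζ : ℂ), Module.End.HasEigenvalue (X x) ζ ∧ orderOf ζ = n := by
  classical
  have (H : Subgroup G) : Fintype (H →* ℂˣ) := Fintype.ofFinite _
  have he : Monoid.exponent G ≠ 0 := Monoid.exponent_ne_zero_of_finite
  have hpow : ∀ (x : G) (ψ : Subgroup.zpowers x →* ℂˣ),
      (ψ ⟨x, Subgroup.mem_zpowers x⟩ : ℂ) ^ Monoid.exponent G = 1 := fun x ψ => by
    rw [← Units.val_pow_eq_pow_val, ← map_pow]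
    have : (⟨x, Subgroup.mem_zpowers x⟩ : Subgroup.zpowers x) ^ Monoid.exponent G = 1 :=
      Subtype.ext (by simp [Monoid.pow_exponent_eq_one])
    rw [this, map_one, Units.val_one]
  have h2 : (0 : ℂ) < 2 ^ n.primeFactors.card := by positivity
  have hG : (0 : ℂ) < (Nat.card G : ℂ)⁻¹ := by
    rw [inv_pos, Nat.cast_pos]
    exact Nat.card_pos
  have hprod : ∀ (x : G) (ψ : Subgroup.zpowers x →* ℂˣ), (0 : ℂ) ≤
      ((∏ p ∈ n.primeFactors, ‖1 - (ψ ⟨x, Subgroup.mem_zpowers x⟩ : ℂ) ^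
          primeExponent (Monoid.exponent G) n p‖ ^ 2 : ℝ) : ℂ) := fun x ψ =>
    Complex.zero_le_real.2 (Finset.prod_nonneg fun _ _ => sq_nonneg _)
  have hterm : ∀ (x : G) (ψ : Subgroup.zpowers x →* ℂˣ), 0 ≤
      LinPair.mult X.character ⟨Subgroup.zpowers x, ψ⟩ *
      ((∏ p ∈ n.primeFactors, ‖1 - (ψ ⟨x, Subgroup.mem_zpowers x⟩ : ℂ) ^
          primeExponent (Monoid.exponent G) n p‖ ^ 2 : ℝ) : ℂ) := fun x ψ =>
    mul_nonneg (mult_character_nonneg X _) (hprod x ψ)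
  rw [← mul_pos_iff_of_pos_left h2, two_pow_mul_schurInner_alternatingAdams,
    mul_pos_iff_of_pos_left hG,
    Finset.sum_pos_iff_of_nonneg fun x _ => Finset.sum_nonneg fun ψ _ => hterm x ψ]
  simp only [Finset.sum_pos_iff_of_nonneg fun ψ _ => hterm _ ψ, Finset.mem_univ, true_and]
  constructor
  · rintro ⟨x, ψ, h⟩
    have hm := (mult_character_nonneg X ⟨Subgroup.zpowers x, ψ⟩).lt_of_ne
      (left_ne_zero_of_mul h.ne').symm
    obtain ⟨v, hv, hv0⟩ := (mult_character_pos_iff X _).1 hm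
    have hne := right_ne_zero_of_mul h.ne'
    rw [Complex.ofReal_ne_zero, Finset.prod_ne_zero_iff] at hne
    refine exists_hasEigenvalue_orderOf_of_dvd (isOfFinOrder_iff_pow_eq_one.2
      ⟨_, Nat.pos_of_ne_zero he, hpow x ψ⟩).orderOf_pos.ne'
      (hasEigenvalue_of_mem_isotypic hv hv0 ⟨x, Subgroup.mem_zpowers x⟩) ?_
    rw [dvd_orderOf_iff_forall_pow_primeExponent_ne_one he hn (hpow x ψ)]
    intro p hp h1
    exact hne p hp (by rw [h1]; simp)
  · rintro ⟨x, ζ, h, ho⟩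
    obtain ⟨ψ, rfl, hv⟩ := exists_isotypic_zpowers_of_hasEigenvalue h
    refine ⟨x, ψ, mul_pos ((mult_character_pos_iff X _).2 hv) (Complex.zero_lt_real.2 ?_)⟩
    refine Finset.prod_pos fun p hp => pow_pos (norm_pos_iff.2 (sub_ne_zero.2 ?_)) 2
    exact ((dvd_orderOf_iff_forall_pow_primeExponent_ne_one he hn (hpow x ψ)).1 ho.symm.dvd p
      hp).symm

/-! ### The conductor and Conjecture A -/

/-- This excludes the default `sInf ∅ = 0`: character values are sums of |G|-th roots of unity, so
|G| is an admissible level. -/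
theorem charConductor_character_pos (X : Representation ℂ G V) :
    0 < charConductor X.character := by
  classical
  have (H : Subgroup G) : Fintype (H →* ℂˣ) := Fintype.ofFinite _
  have hmem : Nat.card G ∈ {n : ℕ | 0 < n ∧ valueField X.character ≤ cyclotomicSubfield n} := by
    refine ⟨Nat.card_pos, IntermediateField.adjoin_le_iff.2 ?_⟩
    rintro _ ⟨x, rfl⟩
    have h := sum_mult_zpowers X.character x ⟨x, Subgroup.mem_zpowers x⟩
    dsimp only at h
    rw [← h]
    refine sum_mem fun ψ _ => mul_mem (IntermediateField.subset_adjoin _ _ ?_) ?_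
    · change _ ^ _ = (1 : ℂ)
      rw [← Units.val_pow_eq_pow_val, ← map_pow]
      have : (⟨x, Subgroup.mem_zpowers x⟩ : Subgroup.zpowers x) ^ Nat.card G = 1 :=
        Subtype.ext (by simp)
      rw [this, map_one, Units.val_one]
    · rw [mult_character]
      exact natCast_mem _ _
  exact (Nat.sInf_mem ⟨_, hmem⟩).1

theorem conjectureA_iff (X : Representation ℂ G V) :
    ConjectureA X.character ↔ ∃ (x : G) (ζ : ℂ), Module.End.HasEigenvalue (X x) ζ ∧
      orderOf ζ = charConductor X.character := by
  constructor
  · rintro ⟨P, hP, ho⟩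
    obtain ⟨v, hv, hv0⟩ := (mult_character_pos_iff X P).1 hP
    have : Finite P.lin.range := Finite.of_surjective _ P.lin.rangeRestrict_surjective
    -- The image of φ is a finite subgroup of ℂˣ, hence cyclic; an element mapping to a generator
    -- has an eigenvalue of order o(φ).
    obtain ⟨y, hy⟩ := IsCyclic.exists_generator (α := P.lin.range)
    obtain ⟨_, h, rfl⟩ := y
    refine ⟨h, P.lin h, hasEigenvalue_of_mem_isotypic hv hv0 h, ?_⟩
    rw [← ho, orderOf_units]
    refine orderOf_eq_orderOf_iff.2 fun k => ⟨fun hk => MonoidHom.ext fun g => ?_, fun hk => ?_⟩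
    · obtain ⟨j, hj⟩ := hy ⟨P.lin g, g, rfl⟩
      have hj' : P.lin h ^ j = P.lin g := congrArg Subtype.val hj
      rw [MonoidHom.pow_apply, ← hj', ← zpow_natCast, zpow_comm, zpow_natCast, hk, one_zpow,
        MonoidHom.one_apply]
    · rw [← MonoidHom.pow_apply, hk, MonoidHom.one_apply]
  · rintro ⟨x, ζ, h, ho⟩
    obtain ⟨ψ, rfl, hv⟩ := exists_isotypic_zpowers_of_hasEigenvalue h
    refine ⟨⟨Subgroup.zpowers x, ψ⟩, (mult_character_pos_iff X _).2 hv, ?_⟩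
    rw [← ho, orderOf_units]
    refine orderOf_eq_orderOf_iff.2 fun k => ⟨fun hk => ?_, fun hk => MonoidHom.ext ?_⟩
    · rw [← MonoidHom.pow_apply, hk, MonoidHom.one_apply]
    · rintro ⟨_, j, rfl⟩
      have e : (⟨x ^ j, j, rfl⟩ : Subgroup.zpowers x) = ⟨x, Subgroup.mem_zpowers x⟩ ^ j := rfl
      change ψ ⟨x ^ j, j, rfl⟩ ^ k = 1
      rw [e, map_zpow, ← zpow_natCast, zpow_comm, zpow_natCast, hk, one_zpow]

end

theorem corollaryC {G : Type*} [Group G] [Finite G]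
    {V : Type*} [AddCommGroup V] [Module ℂ V] [FiniteDimensional ℂ V]
    (X : Representation ℂ G V) (hX : X.IsIrreducible) (χ : G → ℂ) (hχ : χ = X.character) :
    feitIndicator χ = schurInner (alternatingAdams χ (charConductor χ)) (fun _ => 1) ∧
    List.TFAE
      [ConjectureA χ,
       0 < feitIndicator χ,
       0 < schurInner (alternatingAdams χ (charConductor χ)) (fun _ => 1),
       ∃ (x : G) (ζ : ℂ), Module.End.HasEigenvalue (X x) ζ ∧ orderOf ζ = charConductor χ] := by
  subst hχ
  have := Fintype.ofFinite G
  have hc := (charConductor_character_pos X).ne'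
  have hF : feitIndicator X.character = _ := brauerSum_eq_schurInner_alternatingAdams X.character hc
  refine ⟨hF, ?_⟩
  tfae_have 1 ↔ 4 := conjectureA_iff X
  tfae_have 2 ↔ 3 := by rw [hF]
  tfae_have 3 ↔ 4 := schurInner_alternatingAdams_pos_iff X hc
  tfae_finish
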